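/- All syntax is considered up to renaming of bound variables; contexts declare distinct variables; both calculi have the same variables and base types $\tau$. **Source calculus $\lambda_\bigcirc$.** Types $\mathsf S,\mathsf T::=\tau\mid \mathsf S\to \mathsf T\mid\bigcirc \mathsf T$; terms $\mathsf M,\mathsf N::=x\mid\lambda x{:}\mathsf T.\mathsf M\mid \mathsf M\mathsf N\mid \mathrm{quo}\,\mathsf M\mid\mathrm{unq}\,\mathsf M$; contexts $\mathsf\Gamma=x_1{:}\mathsf T_1,\dots,x_k{:}\mathsf T_k$; past stacks $\mathsf\Psi::=\cdot\mid\mathsf\Psi;\mathsf\Gamma$; future stacks $\mathsf\Theta::=\cdot\mid\mathsf\Gamma;\mathsf\Theta$. The judgment $\mathsf\Psi\mid\mathsf\Theta\vdash \mathsf M:\mathsf T$ has the rules: (Var) $\mathsf\Psi;\mathsf\Gamma\mid\mathsf\Theta\vdash x:\mathsf T$ if $\mathsf\Gamma(x)=\mathsf T$; (Abs) from $\mathsf\Psi;\mathsf\Gamma,x{:}\mathsf S\mid\mathsf\Theta\vdash \mathsf M:\mathsf T$ infer $\mathsf\Psi;\mathsf\Gamma\mid\mathsf\Theta\vdash\lambda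 x{:}\mathsf S.\mathsf M:\mathsf S\to \mathsf T$; (App) from $\mathsf\Psi\mid\mathsf\Theta\vdash \mathsf M:\mathsf S\to \mathsf T$ and $\mathsf\Psi\mid\mathsf\Theta\vdash \mathsf N:\mathsf S$ infer $\mathsf\Psi\mid\mathsf\Theta\vdash \mathsf M\mathsf N:\mathsf T$; (Quo) from $\mathsf\Psi;\mathsf\Gamma\mid\mathsf\Theta\vdash \mathsf M:\mathsf T$ infer $\mathsf\Psi\mid\mathsf\Gamma;\mathsf\Theta\vdash\mathrm{quo}\,\mathsf M:\bigcirc \mathsf T$; (Unq) from $\mathsf\Psi\mid\mathsf\Gamma;\mathsf\Theta\vdash \mathsf M:\bigcirc \mathsf T$ infer $\mathsf\Psi;\mathsf\Gamma\mid\mathsf\Theta\vdash\mathrm{unq}\,\mathsf M:\mathsf T$. **Target calculus $\lambda_{\forall[]}$.** There are also context variables $\gamma$ and weakening variables $i$. Types $S,T::=\tau\mid S\to T\mid[\vec S]T\mid\forall\gamma.T$; type sequences $\vec S::=\cdot\mid\vec S,T\mid\vec S,\gamma$; contexts $\Gamma::=\cdot\mid\Gamma,x{:}T\mid\Gamma,i{:}\gamma$;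 stacks $\Psi::=\cdot\mid\Psi;\Gamma$; terms $M,N::=x\mid\lambda x{:}T.M\mid MN\mid\langle\Gamma\rangle M\mid\mathrm{unq}_n(M)[\vec N]\mid\Lambda\gamma.M\mid M@\vec S$; term sequences $\vec N::=\cdot\mid\vec N,M\mid\vec N,i$. Let $rg(\Gamma)$ and $dom(\Gamma)$ be the sequences of the types and context variables, respectively of the variables and weakening variables, of $\Gamma$. The rules are: (Var) $\Psi;\Gamma\vdash x:T$ if $x{:}T\in\Gamma$; the usual (Abs), (App) in the rightmost context; (Quo) from $\Psi;\Gamma\vdash M:T$ infer $\Psi\vdash\langle\Gamma\rangle M:[rg(\Gamma)]T$; (Unq) from $\Psi\vdash M:[\vec T]S$ and $\Psi;\Gamma_n;\dots;\Gamma_1\vdash\vec N:\vec T$ infer $\Psi;\Gamma_n;\dots;\Gamma_1\vdash\mathrm{unq}_n(M)[\vec N]:S$; (Poly) from $\Psi\vdash M:T$, $\gamma$ not free in $\Psi$, infer $\Psi\vdash\Lambda\gamma.M:\forall\gamma.T$; (Inst) from $\Psi\vdash M:\forall\gamma.T$ infer $\Psi\vdash M@\vec S:T[\vec S/\gamma]$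 (capture-avoiding; $\vec S$ is spliced in for $\gamma$). Sequences are typed entry by entry; an entry $i$ gets $\gamma$ if $i{:}\gamma$ is in the rightmost context. In the K variant, $n=1$ in (Unq). **Allocators.** A context (type sequence) allocator is a function $P$ from $\mathbb N$ to contexts (type sequences). Put $\epsilon(x)=\cdot$; $(P\uparrow)(x)=P(x+1)$; $(P\downarrow\Gamma)(0)=\Gamma$, $(P\downarrow\Gamma)(x+1)=P(x)$; $(P\oplus Q)(x)=P(x)\oplus Q(x)$ (concatenation); $rg(P)(x)=rg(P(x))$; $P_{<n}(x)=P(x)$ for $x<n$ and $\cdot$ otherwise; $P_{\ge n}(x)=P(x)$ for $x\ge n$ and $\cdot$ otherwise; $M@_nP=M@P(0)@\cdots@P(n-1)$. Let $D(\tau)=0$, $D(\mathsf S\to\mathsf T)=D(\mathsf T)$, $D(\bigcirc\mathsf T)=D(\mathsf T)+1$. $GenCa(n)=(R,\vec\gamma)$, where $\vec\gamma=\gamma_0,\dots,\gamma_{n-1}$ and $i_0,\dots,i_{n-1}$ are fresh, $R(x)=i_x{:}\gamma_x$ for $x<n$, and $R(x)=\cdot$ for $x\ge n$. **Types.** For a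 type sequence allocator $P$: $\langle P\rangle\tau=\tau$; $\langle P\rangle\bigcirc\mathsf T=[P(0)]\langle P\uparrow\rangle\mathsf T$; $\langle P\rangle(\mathsf S\to\mathsf T)=\forall\vec\gamma.\,\langle rg(R)\rangle\mathsf S\to\langle P\oplus rg(R)\rangle\mathsf T$, where $(R,\vec\gamma)=GenCa(D(\mathsf S))$. For a context allocator $P$, $\langle P\rangle\mathsf T$ means $\langle rg(P)\rangle\mathsf T$. **Contexts and stacks** (all generated variables are fresh). $\Gamma\Leftarrow\langle P\rangle\mathsf\Gamma$: $\cdot\Leftarrow\langle\epsilon\rangle\cdot$; and if $\Gamma\Leftarrow\langle P\rangle\mathsf\Gamma$ and $(R,\vec\gamma)=GenCa(D(\mathsf T))$, then $(\Gamma,x{:}\langle R\rangle\mathsf T)\Leftarrow\langle P\oplus R\rangle(\mathsf\Gamma,x{:}\mathsf T)$. $\Psi\Leftarrow\langle P\rangle\mathsf\Psi$: $\cdot\Leftarrow\langle\epsilon\rangle\cdot$; and if $\Psi\Leftarrow\langle P\rangle\mathsf\Psi$, $\Gamma\Leftarrow\langle R\rangle\mathsf\Gamma$, then $(\Psi;P(0)\oplus\Gamma)\Leftarrow\langle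 P\uparrow\oplus R\rangle(\mathsf\Psi;\mathsf\Gamma)$. $Q\Leftarrow\mathsf\Theta$: $\epsilon\Leftarrow\cdot$; and if $\Gamma\Leftarrow\langle R\rangle\mathsf\Gamma$, $Q\Leftarrow\mathsf\Theta$, then $((R\oplus Q)\downarrow\Gamma)\Leftarrow(\mathsf\Gamma;\mathsf\Theta)$. **Auxiliary terms.** Each of $\mathrm{weak}^{P,Q}_{\mathsf T}$ (for $P(x)\subseteq Q(x)$ for all $x$), $\mathrm{contr}^{P,Q}_{\mathsf T}$, $\mathrm{exchg}^{P,Q,P',Q'}_{\mathsf T}$ converts $\langle A\rangle\mathsf T$ to $\langle B\rangle\mathsf T$, with $(A,B)=(P,Q)$, $(P\oplus P\oplus Q,\,P\oplus Q)$, $(P\oplus Q\oplus P'\oplus Q',\,P\oplus P'\oplus Q\oplus Q')$ respectively. Writing $c_{\mathsf T}$ for the term: $c_\tau=\lambda x{:}\tau.x$; $c_{\mathsf S\to\mathsf T}=\lambda x{:}\langle A\rangle(\mathsf S\to\mathsf T).\Lambda\vec\gamma.\lambda y{:}\langle R\rangle\mathsf S.\;c'_{\mathsf T}\,((x@_{D(\mathsf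 S)}rg(R))\,y)$, where $(R,\vec\gamma)=GenCa(D(\mathsf S))$ and $c'$ has the superscript $(P\oplus R,Q\oplus R)$, $(P,Q\oplus R)$, $(P,Q,P',Q'\oplus R)$ respectively; $c_{\bigcirc\mathsf T}=\lambda x{:}\langle A\rangle\bigcirc\mathsf T.\langle B(0)\rangle\,(c^{\uparrow}_{\mathsf T}\;\mathrm{unq}_1(x)[dom(A(0))])$, where $c^\uparrow$ has $\uparrow$ applied to every superscript. **Terms.** Annotate the subterms of a typed $\lambda_\bigcirc$-term by their types according to its derivation. For $\Psi\Leftarrow\langle P\rangle\mathsf\Psi$ and $Q\Leftarrow\mathsf\Theta$ write $[\![\mathsf M]\!]$ for the translation of $\mathsf M$ at these data. - $[\![x^{\mathsf T}]\!]=\mathrm{weak}^{R,\,P\oplus Q}_{\mathsf T}\,x$, where $R$ was generated for $x$. - $[\![\lambda x{:}\mathsf S.\mathsf M^{\mathsf T}]\!]=\Lambda\vec\gamma.\lambda x{:}\langle R\rangle\mathsf S.\ \mathrm{exchg}^{P,R,Q,\epsilon}_{\mathsf T}\,[\![\mathsf M]\!]$, where $(R,\vec\gamma)=GenCa(D(\mathsf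 S))$ and $\mathsf M$ is translated with the rightmost context extended by $x{:}\langle R\rangle\mathsf S$ and with $P\oplus R$ for $P$. - $[\![\mathsf M^{\mathsf S\to\mathsf T}\mathsf N^{\mathsf S}]\!]=\mathrm{contr}^{A_{<n},A_{\ge n}}_{\mathsf T}\big(([\![\mathsf M]\!]@_n rg(A))\,[\![\mathsf N]\!]\big)$, where $A=P\oplus Q$ and $n=D(\mathsf S)$. - $[\![\mathrm{quo}\,\mathsf M]\!]=\langle P(0)\oplus\Gamma\rangle[\![\mathsf M]\!]$ for the future stack $\mathsf\Gamma;\mathsf\Theta$ with $\Gamma\Leftarrow\langle R\rangle\mathsf\Gamma$ and $Q\Leftarrow\mathsf\Theta$, where $\mathsf M$ is translated at $\Psi;P(0)\oplus\Gamma\Leftarrow\langle P\uparrow\oplus R\rangle(\mathsf\Psi;\mathsf\Gamma)$ and $Q\Leftarrow\mathsf\Theta$. - $[\![\mathrm{unq}\,\mathsf M]\!]=\mathrm{unq}_1([\![\mathsf M]\!])[dom(P(0)\oplus\Gamma)]$ for the past stack $\mathsf\Psi;\mathsf\Gamma$ with $\Psi\Leftarrow\langle P\rangle\mathsf\Psi$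 and $\Gamma\Leftarrow\langle R\rangle\mathsf\Gamma$, where $\mathsf M$ is translated at $\Psi\Leftarrow\langle P\rangle\mathsf\Psi$ and $(R\oplus Q)\downarrow\Gamma\Leftarrow(\mathsf\Gamma;\mathsf\Theta)$. **Theorem (soundness of context extraction).** Suppose $\mathsf\Psi\mid\mathsf\Theta\vdash\mathsf M:\mathsf T$ is derivable in $\lambda_\bigcirc$. Then generative translations $\Psi\Leftarrow\langle P\rangle\mathsf\Psi$ and $Q\Leftarrow\mathsf\Theta$ exist, and for every choice of them $$\Psi\ \vdash\ [\![\mathsf M]\!]\ :\ \langle P\oplus Q\rangle\mathsf T$$ is derivable in the K variant of $\lambda_{\forall[]}$. -/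

import Mathlib

/-!
Both calculi are formalized up to renaming of bound variables, with nameless (de Bruijn) syntax.

* A term variable or weakening variable is a number: its position, counted from the right and
  starting with `0`, in the current (rightmost) context of the context stack.
* A context variable is a number; `∀γ. T` and `Λγ. M` bind the number `0`, and the free context
  variables are the remaining numbers.
* Entries of a context carry no names, so that a context is the sequence of the types and context
  variables that its entries are declared with, and the range of a context is the context itself.
* In lists of contexts (context stacks) the head is the context next to the turnstile (past and
  target stacks) or next to the bar (future stacks).
-/

namespace ContextExtraction

universe u

/-! ### The target calculus: types, type sequences, contexts -/

mutual
/-- Types `τ`, `S → T`, `[S₁, …, Sₙ]T`, `∀γ. T` over a set `B` of base types. -/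
inductive Ty (B : Type u) : Type u
  | base : B → Ty B
  | arr : Ty B → Ty B → Ty B
  | box : TySeq B → Ty B → Ty B
  | all : Ty B → Ty B
/-- Type sequences, built from types and context variables. -/
inductive TySeq (B : Type u) : Type u
  | nil : TySeq B
  | snoc : TySeq B → Ty B → TySeq B
  | snocC : TySeq B → ℕ → TySeq B
end

/-- Contexts: the entries `x : T` and `i : γ` are `snoc` and `snocC`, without the names. -/
abbrev Ctx (B : Type u) : Type u := TySeq B

/-- Context stacks; the head is the current (object-level) context. -/
abbrev Stack (B : Type u) : Type u := List (Ctx B)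

variable {B : Type u}

/-- Concatenation `S ⊕ T` of type sequences (and of contexts). -/
def TySeq.append (S : TySeq B) : TySeq B → TySeq B
  | .nil => S
  | .snoc U T => .snoc (S.append U) T
  | .snocC U γ => .snocC (S.append U) γ

instance : Append (TySeq B) := ⟨TySeq.append⟩

/-- Number of entries. -/
def TySeq.length : TySeq B → ℕ
  | .nil => 0
  | .snoc U _ => U.length + 1
  | .snocC U _ => U.length + 1

/-- Passing below a binder of a context variable. -/
def liftRen (ρ : ℕ → ℕ) : ℕ → ℕ
  | 0 => 0
  | k + 1 => ρ k + 1

mutual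
/-- Renaming of the free context variables of a type. -/
def Ty.rename (ρ : ℕ → ℕ) : Ty B → Ty B
  | .base b => .base b
  | .arr S T => .arr (S.rename ρ) (T.rename ρ)
  | .box S T => .box (S.rename ρ) (T.rename ρ)
  | .all T => .all (T.rename (liftRen ρ))
/-- Renaming of the free context variables of a type sequence. -/
def TySeq.rename (ρ : ℕ → ℕ) : TySeq B → TySeq B
  | .nil => .nil
  | .snoc U T => .snoc (U.rename ρ) (T.rename ρ)
  | .snocC U γ => .snocC (U.rename ρ) (ρ γ)
end

/-- Passing below a binder of a context variable. -/
def liftSub (σ : ℕ → TySeq B) : ℕ → TySeq B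
  | 0 => .snocC .nil 0
  | k + 1 => (σ k).rename Nat.succ

mutual
/-- Simultaneous capture-avoiding substitution of type sequences for the context variables of a
type. -/
def Ty.subst (σ : ℕ → TySeq B) : Ty B → Ty B
  | .base b => .base b
  | .arr S T => .arr (S.subst σ) (T.subst σ)
  | .box S T => .box (S.subst σ) (T.subst σ)
  | .all T => .all (T.subst (liftSub σ))
/-- Simultaneous substitution in a type sequence: what replaces `γ` is spliced in. -/
def TySeq.subst (σ : ℕ → TySeq B) : TySeq B → TySeq B
  | .nil => .nil
  | .snoc U T => .snoc (U.subst σ) (T.subst σ)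
  | .snocC U γ => (U.subst σ).append (σ γ)
end

/-- The substitution that replaces the outermost bound context variable by `S`. -/
def inst (S : TySeq B) : ℕ → TySeq B
  | 0 => S
  | k + 1 => .snocC .nil k

/-! ### The target calculus: terms and typing -/

mutual
/-- Terms. `quo Γ M` is the quotation of `M` with context `Γ`, `unq n M N` the unquotation of `M`
over `n` levels with explicit environment `N`, `clam M` is `Λγ. M` and `capp M S` is `M @ S`. -/
inductive Tm (B : Type u) : Type u
  | var : ℕ → Tm B
  | lam : Ty B → Tm B → Tm B
  | app : Tm B → Tm B → Tm B
  | quo : Ctx B → Tm B → Tm B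
  | unq : ℕ → Tm B → TmSeq B → Tm B
  | clam : Tm B → Tm B
  | capp : Tm B → TySeq B → Tm B
/-- Term sequences, built from terms and weakening variables. -/
inductive TmSeq (B : Type u) : Type u
  | nil : TmSeq B
  | snoc : TmSeq B → Tm B → TmSeq B
  | snocW : TmSeq B → ℕ → TmSeq B
end

/-- Concatenation of term sequences. -/
def TmSeq.append (M : TmSeq B) : TmSeq B → TmSeq B
  | .nil => M
  | .snoc N t => .snoc (M.append N) t
  | .snocW N i => .snocW (M.append N) i

instance : Append (TmSeq B) := ⟨TmSeq.append⟩

/-- `HasVar Γ x T`: the entry of `Γ` at position `x` is a variable of type `T`. -/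
inductive HasVar : Ctx B → ℕ → Ty B → Prop
  | here {Γ : Ctx B} {T : Ty B} : HasVar (.snoc Γ T) 0 T
  | thereV {Γ : Ctx B} {S T : Ty B} {x : ℕ} : HasVar Γ x T → HasVar (.snoc Γ S) (x + 1) T
  | thereC {Γ : Ctx B} {T : Ty B} {x γ : ℕ} : HasVar Γ x T → HasVar (.snocC Γ γ) (x + 1) T

/-- `HasWVar Γ i γ`: the entry of `Γ` at position `i` is a weakening variable declared with the
context variable `γ`. -/
inductive HasWVar : Ctx B → ℕ → ℕ → Prop
  | here {Γ : Ctx B} {γ : ℕ} : HasWVar (.snocC Γ γ) 0 γ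
  | thereV {Γ : Ctx B} {S : Ty B} {i γ : ℕ} : HasWVar Γ i γ → HasWVar (.snoc Γ S) (i + 1) γ
  | thereC {Γ : Ctx B} {i γ δ : ℕ} : HasWVar Γ i γ → HasWVar (.snocC Γ δ) (i + 1) γ

/-- The four variants of the calculus. -/
inductive Variant
  | K
  | T
  | K4
  | S4

/-- The numbers of levels over which unquotation is possible. -/
def Variant.Allows : Variant → ℕ → Prop
  | .K, n => n = 1
  | .T, n => n = 0 ∨ n = 1
  | .K4, n => 1 ≤ n
  | .S4, _ => True

mutual
/-- The term judgment `Ψ ⊢ M : T` of the chosen variant. In `poly` the context variable bound by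
`Λ` is new for `Ψ`: the free context variables of `Ψ` are moved away from `0`. -/
inductive Typed (v : Variant) : Stack B → Tm B → Ty B → Prop
  | var {Ψ : Stack B} {Γ : Ctx B} {x : ℕ} {T : Ty B} :
      HasVar Γ x T → Typed v (Γ :: Ψ) (.var x) T
  | abs {Ψ : Stack B} {Γ : Ctx B} {M : Tm B} {S T : Ty B} :
      Typed v (.snoc Γ T :: Ψ) M S → Typed v (Γ :: Ψ) (.lam T M) (.arr T S)
  | app {Ψ : Stack B} {Γ : Ctx B} {M N : Tm B} {S T : Ty B} :
      Typed v (Γ :: Ψ) M (.arr T S) → Typed v (Γ :: Ψ) N T → Typed v (Γ :: Ψ) (.app M N) S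
  | quo {Ψ : Stack B} {Γ : Ctx B} {M : Tm B} {T : Ty B} :
      Typed v (Γ :: Ψ) M T → Typed v Ψ (.quo Γ M) (.box Γ T)
  | unq {Ψ Δ : Stack B} {n : ℕ} {M : Tm B} {N : TmSeq B} {T : TySeq B} {S : Ty B} :
      v.Allows n → Δ.length = n → Typed v Ψ M (.box T S) → TypedSeq v (Δ ++ Ψ) N T →
      Typed v (Δ ++ Ψ) (.unq n M N) S
  | poly {Ψ : Stack B} {M : Tm B} {T : Ty B} :
      Typed v (Ψ.map (TySeq.rename Nat.succ)) M T → Typed v Ψ (.clam M) (.all T)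
  | inst {Ψ : Stack B} {M : Tm B} {T : Ty B} (S : TySeq B) :
      Typed v Ψ M (.all T) → Typed v Ψ (.capp M S) (T.subst (inst S))
/-- The sequence judgment `Ψ ⊢ N₁, …, Nₘ : T₁, …, Tₘ`. -/
inductive TypedSeq (v : Variant) : Stack B → TmSeq B → TySeq B → Prop
  | unit {Ψ : Stack B} : TypedSeq v Ψ .nil .nil
  | seq {Ψ : Stack B} {N : TmSeq B} {M : Tm B} {S : TySeq B} {T : Ty B} :
      TypedSeq v Ψ N S → Typed v Ψ M T → TypedSeq v Ψ (.snoc N M) (.snoc S T)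
  | seqC {Ψ : Stack B} {Γ : Ctx B} {N : TmSeq B} {S : TySeq B} {i γ : ℕ} :
      TypedSeq v (Γ :: Ψ) N S → HasWVar Γ i γ → TypedSeq v (Γ :: Ψ) (.snocW N i) (.snocC S γ)
end

/-! ### The source calculus (linear-temporal types) -/

/-- Types `τ`, `S → T`, `○T`. -/
inductive LTy (B : Type u) : Type u
  | base : B → LTy B
  | arr : LTy B → LTy B → LTy B
  | circ : LTy B → LTy B

/-- Terms `x`, `λx:S. M`, `M N`, quotation and unquotation. -/
inductive LTm (B : Type u) : Type u
  | var : ℕ → LTm B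
  | lam : LTy B → LTm B → LTm B
  | app : LTm B → LTm B → LTm B
  | quo : LTm B → LTm B
  | unq : LTm B → LTm B

/-- Contexts; the head is the rightmost entry. -/
abbrev LCtx (B : Type u) : Type u := List (LTy B)

/-- Derivations of `Ψ | Θ ⊢ M : T`. They are data: a derivation determines the type annotations
of `M` which the translation of terms refers to. -/
inductive LDer : List (LCtx B) → List (LCtx B) → LTm B → LTy B → Type u
  | var {Ψ Θ : List (LCtx B)} {Γ : LCtx B} {T : LTy B} (x : ℕ) :
      Γ[x]? = some T → LDer (Γ :: Ψ) Θ (.var x) T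
  | abs {Ψ Θ : List (LCtx B)} {Γ : LCtx B} {M : LTm B} {S T : LTy B} :
      LDer ((S :: Γ) :: Ψ) Θ M T → LDer (Γ :: Ψ) Θ (.lam S M) (.arr S T)
  | app {Ψ Θ : List (LCtx B)} {M N : LTm B} {S T : LTy B} :
      LDer Ψ Θ M (.arr S T) → LDer Ψ Θ N S → LDer Ψ Θ (.app M N) T
  | quo {Ψ Θ : List (LCtx B)} {Γ : LCtx B} {M : LTm B} {T : LTy B} :
      LDer (Γ :: Ψ) Θ M T → LDer Ψ (Γ :: Θ) (.quo M) (.circ T)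
  | unq {Ψ Θ : List (LCtx B)} {Γ : LCtx B} {M : LTm B} {T : LTy B} :
      LDer Ψ (Γ :: Θ) M (.circ T) → LDer (Γ :: Ψ) Θ (.unq M) T

/-! ### Allocators -/

/-- Context allocators and type sequence allocators. -/
abbrev Alloc (B : Type u) : Type u := ℕ → TySeq B

instance : Append (Alloc B) := ⟨fun P Q x => P x ++ Q x⟩

namespace Alloc

/-- The empty allocator `ε`. -/
def empty : Alloc B := fun _ => .nil

/-- `P↑`. -/
def up (P : Alloc B) : Alloc B := fun x => P (x + 1)

/-- `P↓Γ`. -/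
def down (P : Alloc B) (Γ : TySeq B) : Alloc B
  | 0 => Γ
  | x + 1 => P x

/-- The part of an allocator at the levels `0, …, n - 1`. -/
def below (P : Alloc B) (n : ℕ) : Alloc B := fun x => if x < n then P x else .nil

/-- The part of an allocator at the levels `n, n + 1, …`. -/
def above (P : Alloc B) (n : ℕ) : Alloc B := fun x => if x < n then .nil else P x

/-- Passing below `n` binders of context variables. -/
def shift (P : Alloc B) (n : ℕ) : Alloc B := fun x => (P x).rename (· + n)

/-- `GenCa` for the context variables `γ₀, …, γₙ₋₁`: the context `i : γₓ` at every level `x < n`,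
and the empty context at all other levels. -/
def gen {n : ℕ} (γ : Fin n → ℕ) : Alloc B :=
  fun x => if h : x < n then .snocC .nil (γ ⟨x, h⟩) else .nil

end Alloc

/-- The context variables bound by a block `∀γ₀ … γₙ₋₁` or `Λγ₀ … γₙ₋₁`, seen from inside. -/
def boundVars (n : ℕ) : Fin n → ℕ := fun x => x.rev

/-- `∀γ₀ … γₙ₋₁. T`. -/
def allN : ℕ → Ty B → Ty B
  | 0, T => T
  | n + 1, T => .all (allN n T)

/-- `Λγ₀ … γₙ₋₁. M`. -/
def clamN : ℕ → Tm B → Tm B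
  | 0, M => M
  | n + 1, M => .clam (clamN n M)

/-- `M @ P(0) … @ P(n - 1)`. -/
def cappN (M : Tm B) (P : Alloc B) : ℕ → Tm B
  | 0 => M
  | n + 1 => .capp (cappN M P n) (P n)

/-! ### Translation of types -/

/-- Context depth. -/
def LTy.depth : LTy B → ℕ
  | .base _ => 0
  | .arr _ T => T.depth
  | .circ T => T.depth + 1

/-- The translation `⟨P⟩T` of types. -/
def trTy (P : Alloc B) : LTy B → Ty B
  | .base b => .base b
  | .arr S T =>
      let n := S.depth
      let R : Alloc B := .gen (boundVars n)
      allN n (.arr (trTy R S) (trTy (P.shift n ++ R) T))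
  | .circ T => .box (P 0) (trTy P.up T)

/-! ### Generative translations of contexts -/

/-- A derivation of a generative translation `Γ' ⇐ ⟨P⟩Γ`: a choice of the generated context
variables for every entry of `Γ`. -/
inductive GenCtx : LCtx B → Type u
  | nil : GenCtx []
  | snoc {Γ : LCtx B} (g : GenCtx Γ) (T : LTy B) (γ : Fin T.depth → ℕ) : GenCtx (T :: Γ)

namespace GenCtx

/-- The generated allocator. -/
def alloc {Γ : LCtx B} : GenCtx Γ → Alloc B
  | .nil => .empty
  | .snoc g _ γ => g.alloc ++ .gen γ

/-- The translated context. -/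
def ctx {Γ : LCtx B} : GenCtx Γ → Ctx B
  | .nil => .nil
  | .snoc g T γ => .snoc g.ctx (trTy (.gen γ) T)

/-- The generated context variables. -/
def cvars {Γ : LCtx B} : GenCtx Γ → List ℕ
  | .nil => []
  | .snoc g _ γ => g.cvars ++ List.ofFn γ

/-- Passing below `n` binders of context variables. -/
def shift {Γ : LCtx B} (n : ℕ) : GenCtx Γ → GenCtx Γ
  | .nil => .nil
  | .snoc g T γ => .snoc (g.shift n) T (fun x => γ x + n)

/-- The allocator that was generated for the variable `x`. -/
def varAlloc {Γ : LCtx B} : GenCtx Γ → ℕ → Alloc B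
  | .nil, _ => .empty
  | .snoc _ _ γ, 0 => .gen γ
  | .snoc g _ _, x + 1 => g.varAlloc x

/-- The allocator that was generated for the variables to the right of the variable `x`. -/
def allocAfter {Γ : LCtx B} : GenCtx Γ → ℕ → Alloc B
  | .nil, _ => .empty
  | .snoc _ _ _, 0 => .empty
  | .snoc g _ γ, x + 1 => g.allocAfter x ++ .gen γ

end GenCtx

/-- A derivation of a generative translation `Ψ' ⇐ ⟨P⟩Ψ` of a past context stack. -/
inductive GenPast : List (LCtx B) → Type u
  | nil : GenPast []
  | snoc {Ψ : List (LCtx B)} {Γ : LCtx B} (p : GenPast Ψ) (g : GenCtx Γ) : GenPast (Γ :: Ψ)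

namespace GenPast

/-- The generated allocator. -/
def alloc {Ψ : List (LCtx B)} : GenPast Ψ → Alloc B
  | .nil => .empty
  | .snoc p g => p.alloc.up ++ g.alloc

/-- The translated context stack. -/
def stack {Ψ : List (LCtx B)} : GenPast Ψ → Stack B
  | .nil => []
  | .snoc p g => (p.alloc 0 ++ g.ctx) :: p.stack

/-- The generated context variables. -/
def cvars {Ψ : List (LCtx B)} : GenPast Ψ → List ℕ
  | .nil => []
  | .snoc p g => p.cvars ++ g.cvars

/-- Passing below `n` binders of context variables. -/
def shift {Ψ : List (LCtx B)} (n : ℕ) : GenPast Ψ → GenPast Ψ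
  | .nil => .nil
  | .snoc p g => .snoc (p.shift n) (g.shift n)

end GenPast

/-- A derivation of a generative translation `Q ⇐ Θ` of a future context stack. -/
inductive GenFuture : List (LCtx B) → Type u
  | nil : GenFuture []
  | cons {Γ : LCtx B} {Θ : List (LCtx B)} (g : GenCtx Γ) (f : GenFuture Θ) : GenFuture (Γ :: Θ)

namespace GenFuture

/-- The allocator to which the future context stack is translated. -/
def alloc {Θ : List (LCtx B)} : GenFuture Θ → Alloc B
  | .nil => .empty
  | .cons g f => (g.alloc ++ f.alloc).down g.ctx

/-- The generated context variables. -/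
def cvars {Θ : List (LCtx B)} : GenFuture Θ → List ℕ
  | .nil => []
  | .cons g f => g.cvars ++ f.cvars

/-- Passing below `n` binders of context variables. -/
def shift {Θ : List (LCtx B)} (n : ℕ) : GenFuture Θ → GenFuture Θ
  | .nil => .nil
  | .cons g f => .cons (g.shift n) (f.shift n)

end GenFuture

/-- The generated context variables are fresh: no two of them coincide. -/
def Fresh {Ψ Θ : List (LCtx B)} (p : GenPast Ψ) (f : GenFuture Θ) : Prop :=
  (p.cvars ++ f.cvars).Nodup

/-! ### Weakening, contraction and exchange of allocators -/

/-- `dom(Γ)` as a term sequence in a context that has the entry `k` of `Γ` at position `ι k`. -/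
def domVia : Ctx B → (ℕ → ℕ) → TmSeq B
  | .nil, _ => .nil
  | .snoc Γ _, ι => .snoc (domVia Γ (fun k => ι (k + 1))) (.var (ι 0))
  | .snocC Γ _, ι => .snocW (domVia Γ (fun k => ι (k + 1))) (ι 0)

/-- From an inclusion of `Γ` in `Δ` to the inclusion of `Γ ⊕ Ξ` in `Δ ⊕ Ξ`, where `Ξ` has `m`
entries. -/
def liftPos (m : ℕ) (ι : ℕ → ℕ) : ℕ → ℕ := fun k => if k < m then k else ι (k - m) + m

/-- The term `weak`, of type `⟨P⟩T → ⟨Q⟩T`, for `P(x) ⊆ Q(x)` at all levels `x`. As entries have no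
names, the inclusion is given explicitly: the entry `k` of `P(x)` is the entry `ι x k` of `Q(x)`. -/
def weak (P Q : Alloc B) (ι : ℕ → ℕ → ℕ) : LTy B → Tm B
  | .base b => .lam (.base b) (.var 0)
  | .arr S T =>
      let n := S.depth
      let R : Alloc B := .gen (boundVars n)
      .lam (trTy P (.arr S T)) (clamN n (.lam (trTy R S)
        (.app (weak (P.shift n ++ R) (Q.shift n ++ R) (fun x => liftPos (R x).length (ι x)) T)
          (.app (cappN (.var 1) R n) (.var 0)))))
  | .circ T =>
      .lam (trTy P (.circ T)) (.quo (Q 0)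
        (.app (weak P.up Q.up (fun x => ι (x + 1)) T)
          (.unq 1 (.var 0) (domVia (P 0) (ι 0)))))

/-- The term `contr`, of type `⟨P ⊕ P ⊕ Q⟩T → ⟨P ⊕ Q⟩T`. -/
def contr (P Q : Alloc B) : LTy B → Tm B
  | .base b => .lam (.base b) (.var 0)
  | .arr S T =>
      let n := S.depth
      let R : Alloc B := .gen (boundVars n)
      .lam (trTy (P ++ P ++ Q) (.arr S T)) (clamN n (.lam (trTy R S)
        (.app (contr (P.shift n) (Q.shift n ++ R) T)
          (.app (cappN (.var 1) R n) (.var 0)))))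
  | .circ T =>
      let q := (Q 0).length
      .lam (trTy (P ++ P ++ Q) (.circ T)) (.quo (P 0 ++ Q 0)
        (.app (contr P.up Q.up T)
          (.unq 1 (.var 0)
            (domVia (P 0) (· + q) ++ domVia (P 0) (· + q) ++ domVia (Q 0) id))))

/-- The term `exchg`, of type `⟨P ⊕ Q ⊕ P' ⊕ Q'⟩T → ⟨P ⊕ P' ⊕ Q ⊕ Q'⟩T`. -/
def exchg (P Q P' Q' : Alloc B) : LTy B → Tm B
  | .base b => .lam (.base b) (.var 0)
  | .arr S T =>
      let n := S.depth
      let R : Alloc B := .gen (boundVars n)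
      .lam (trTy (P ++ Q ++ P' ++ Q') (.arr S T)) (clamN n (.lam (trTy R S)
        (.app (exchg (P.shift n) (Q.shift n) (P'.shift n) (Q'.shift n ++ R) T)
          (.app (cappN (.var 1) R n) (.var 0)))))
  | .circ T =>
      let q := (Q 0).length
      let p' := (P' 0).length
      let q' := (Q' 0).length
      .lam (trTy (P ++ Q ++ P' ++ Q') (.circ T)) (.quo (P 0 ++ P' 0 ++ Q 0 ++ Q' 0)
        (.app (exchg P.up Q.up P'.up Q'.up T)
          (.unq 1 (.var 0)
            (domVia (P 0) (· + (p' + q + q')) ++ domVia (Q 0) (· + q')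
              ++ domVia (P' 0) (· + (q + q')) ++ domVia (Q' 0) id))))

/-! ### Translation of terms -/

/-- The translation of terms (annotated as the derivation says) for given generative translations
of the past and the future context stack.

In an application the function is instantiated at the levels `0, …, D(S) - 1` only, so that its
result has type `⟨A ⊕ A'⟩T` with `A'` the part of `A` at these levels; only this part is
contracted. For a variable, the allocator generated for it is a block of the whole allocator at
each level, followed by what was generated for the variables to its right and by the future. -/
def trTm {Ψ Θ : List (LCtx B)} {M : LTm B} {T : LTy B} :
    LDer Ψ Θ M T → GenPast Ψ → GenFuture Θ → Tm B
  | .var (T := T) x _, .snoc p g, f =>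
      .app (weak (g.varAlloc x) ((GenPast.snoc p g).alloc ++ f.alloc)
          (fun l k => k + (g.allocAfter x l).length + (f.alloc l).length) T)
        (.var x)
  | .abs (S := S) (T := T) d, .snoc p g, f =>
      let n := S.depth
      let R : Alloc B := .gen (boundVars n)
      let p' := p.shift n
      let g' := g.shift n
      let f' := f.shift n
      clamN n (.lam (trTy R S)
        (.app (exchg (GenPast.snoc p' g').alloc R f'.alloc .empty T)
          (trTm d (.snoc p' (.snoc g' S (boundVars n))) f')))
  | .app (S := S) (T := T) d e, p, f =>
      let A := p.alloc ++ f.alloc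
      .app (contr (A.below S.depth) (A.above S.depth) T)
        (.app (cappN (trTm d p f) A S.depth) (trTm e p f))
  | .quo d, p, .cons g f => .quo (p.alloc 0 ++ g.ctx) (trTm d (.snoc p g) f)
  | .unq d, .snoc p g, f =>
      .unq 1 (trTm d p (.cons g f)) (domVia (p.alloc 0 ++ g.ctx) id)

end ContextExtraction

open ContextExtraction

-- The proof is an induction on the source derivation, for all generative translations of the two
-- stacks at once. Quotation and unquotation only move `Γ` between the stacks: unfolding `⟨P ⊕ (R ⊕
-- Q)↓Γ⟩○T` gives a box over `P(0) ⊕ Γ` with body at `P↑ ⊕ (R ⊕ Q)`, which is the allocator on the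
-- other side up to associativity. In the remaining cases the allocator obtained differs from the
-- one required only in which blocks occur and in what order. A variable has just its own block `R`
-- and must be weakened to the whole allocator. The body of an abstraction comes with `P ⊕ R ⊕ Q`
-- where the function type asks for `P ⊕ Q ⊕ R`. Instantiating a function at the levels below `n =
-- D(S)` duplicates these levels of `A`, giving `A ⊕ A_{<n}`, which is to be contracted to `A`.
--
-- Two groups of facts carry this. The conversion terms have their intended types (`typed_weak`,
-- `typed_contr`, `typed_exchg`), by induction on the source type, with the arrow and circle cases
-- shared in `typed_conv_arr` and `typed_conv_circ`. Instantiating a block of quantifiers acts on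
-- allocators as expected (`typed_cappN`); this rests on `subst_trTy`, by which substitution passes
-- through the translation of types to the allocator, and on `trTy_congr`, by which the levels that
-- are not instantiated do not matter to the argument type.
--
-- Fresh choices exist because the generated context variables can be numbered consecutively.

namespace ContextExtraction

variable {B : Type*}

/-! ### Type sequences -/

namespace TySeq

@[simp] theorem append_eq (S T : TySeq B) : S.append T = S ++ T := rfl

@[simp] theorem append_nil (S : TySeq B) : S ++ (nil : TySeq B) = S := rfl

@[simp] theorem append_snoc (S U : TySeq B) (T : Ty B) : S ++ U.snoc T = (S ++ U).snoc T := rfl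

@[simp] theorem append_snocC (S U : TySeq B) (γ : ℕ) : S ++ U.snocC γ = (S ++ U).snocC γ := rfl

@[simp] theorem nil_append : ∀ S : TySeq B, nil ++ S = S
  | nil => rfl
  | snoc U T => by rw [append_snoc, nil_append U]
  | snocC U γ => by rw [append_snocC, nil_append U]

theorem append_assoc (S T : TySeq B) : ∀ U : TySeq B, S ++ T ++ U = S ++ (T ++ U)
  | nil => rfl
  | snoc U _ => by simp only [append_snoc, append_assoc S T U]
  | snocC U _ => by simp only [append_snocC, append_assoc S T U]

theorem length_append (S : TySeq B) : ∀ T : TySeq B, (S ++ T).length = S.length + T.length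
  | nil => rfl
  | snoc U _ => by simp only [append_snoc, length, length_append S U, Nat.add_assoc]
  | snocC U _ => by simp only [append_snocC, length, length_append S U, Nat.add_assoc]

theorem rename_append (ρ : ℕ → ℕ) (S : TySeq B) :
    ∀ T : TySeq B, (S ++ T).rename ρ = S.rename ρ ++ T.rename ρ
  | nil => by simp [rename]
  | snoc U _ => by simp [rename, rename_append ρ S U]
  | snocC U _ => by simp [rename, rename_append ρ S U]

theorem subst_append (σ : ℕ → TySeq B) (S : TySeq B) :
    ∀ T : TySeq B, (S ++ T).subst σ = S.subst σ ++ T.subst σ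
  | nil => by simp [subst]
  | snoc U _ => by simp [subst, subst_append σ S U]
  | snocC U _ => by simp [subst, subst_append σ S U, append_assoc]

end TySeq

/-! ### Renaming and substitution of context variables -/

/-- The identity substitution. -/
def idSub : ℕ → TySeq B := fun k => .snocC .nil k

theorem liftSub_idSub_comp (ρ : ℕ → ℕ) :
    liftSub (fun k => (idSub (ρ k) : TySeq B)) = fun k => idSub (liftRen ρ k) := by
  funext k
  cases k <;> simp [liftSub, idSub, liftRen, TySeq.rename]

mutual
-- Reduces facts about renaming, such as `rename_trTy`, to facts about substitution.
theorem Ty.rename_eq_subst (ρ : ℕ → ℕ) :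
    ∀ T : Ty B, T.rename ρ = T.subst (fun k => idSub (ρ k))
  | .base _ => by simp [Ty.rename, Ty.subst]
  | .arr S T => by
      simp only [Ty.rename, Ty.subst, Ty.rename_eq_subst ρ S, Ty.rename_eq_subst ρ T]
  | .box S T => by
      simp only [Ty.rename, Ty.subst, TySeq.rename_eq_subst ρ S, Ty.rename_eq_subst ρ T]
  | .all T => by
      simp only [Ty.rename, Ty.subst, Ty.rename_eq_subst (liftRen ρ) T, liftSub_idSub_comp]
theorem TySeq.rename_eq_subst (ρ : ℕ → ℕ) :
    ∀ S : TySeq B, S.rename ρ = S.subst (fun k => idSub (ρ k))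
  | .nil => by simp [TySeq.rename, TySeq.subst]
  | .snoc U T => by
      simp only [TySeq.rename, TySeq.subst, TySeq.rename_eq_subst ρ U, Ty.rename_eq_subst ρ T]
  | .snocC U γ => by
      simp [TySeq.rename, TySeq.subst, TySeq.rename_eq_subst ρ U, idSub]
end

theorem liftRen_id : liftRen (fun k => k) = fun k => k := by
  funext k
  cases k <;> rfl

mutual
theorem Ty.subst_idSub : ∀ T : Ty B, T.subst idSub = T
  | .base _ => by simp [Ty.subst]
  | .arr S T => by simp only [Ty.subst, Ty.subst_idSub S, Ty.subst_idSub T]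
  | .box S T => by simp only [Ty.subst, TySeq.subst_idSub S, Ty.subst_idSub T]
  | .all T => by
      have h : liftSub (idSub : ℕ → TySeq B) = idSub := by
        simpa [liftRen_id] using liftSub_idSub_comp (B := B) (fun k => k)
      simp only [Ty.subst, h, Ty.subst_idSub T]
theorem TySeq.subst_idSub : ∀ S : TySeq B, S.subst idSub = S
  | .nil => by simp [TySeq.subst]
  | .snoc U T => by simp only [TySeq.subst, TySeq.subst_idSub U, Ty.subst_idSub T]
  | .snocC U γ => by simp [TySeq.subst, TySeq.subst_idSub U, idSub]
end

theorem liftRen_comp (ρ ρ' : ℕ → ℕ) :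
    (fun k => liftRen ρ' (liftRen ρ k)) = liftRen (fun k => ρ' (ρ k)) := by
  funext k
  cases k <;> rfl

mutual
theorem Ty.rename_rename (ρ ρ' : ℕ → ℕ) :
    ∀ T : Ty B, (T.rename ρ).rename ρ' = T.rename (fun k => ρ' (ρ k))
  | .base _ => by simp [Ty.rename]
  | .arr S T => by simp only [Ty.rename, Ty.rename_rename ρ ρ' S, Ty.rename_rename ρ ρ' T]
  | .box S T => by simp only [Ty.rename, TySeq.rename_rename ρ ρ' S, Ty.rename_rename ρ ρ' T]
  | .all T => by
      simp only [Ty.rename, Ty.rename_rename (liftRen ρ) (liftRen ρ') T, liftRen_comp]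
theorem TySeq.rename_rename (ρ ρ' : ℕ → ℕ) :
    ∀ S : TySeq B, (S.rename ρ).rename ρ' = S.rename (fun k => ρ' (ρ k))
  | .nil => by simp [TySeq.rename]
  | .snoc U T => by
      simp only [TySeq.rename, TySeq.rename_rename ρ ρ' U, Ty.rename_rename ρ ρ' T]
  | .snocC U γ => by simp only [TySeq.rename, TySeq.rename_rename ρ ρ' U]
end

theorem liftSub_comp_liftRen (ρ : ℕ → ℕ) (σ : ℕ → TySeq B) :
    (fun k => liftSub σ (liftRen ρ k)) = liftSub (fun k => σ (ρ k)) := by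
  funext k
  cases k <;> rfl

mutual
-- This law and `Ty.rename_subst` are what `Ty.subst_subst` needs below a binder, where `liftSub`
-- renames the substituted sequences.
theorem Ty.subst_rename (ρ : ℕ → ℕ) (σ : ℕ → TySeq B) :
    ∀ T : Ty B, (T.rename ρ).subst σ = T.subst (fun k => σ (ρ k))
  | .base _ => by simp [Ty.rename, Ty.subst]
  | .arr S T => by
      simp only [Ty.rename, Ty.subst, Ty.subst_rename ρ σ S, Ty.subst_rename ρ σ T]
  | .box S T => by
      simp only [Ty.rename, Ty.subst, TySeq.subst_rename ρ σ S, Ty.subst_rename ρ σ T]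
  | .all T => by
      simp only [Ty.rename, Ty.subst, Ty.subst_rename (liftRen ρ) (liftSub σ) T,
        liftSub_comp_liftRen]
theorem TySeq.subst_rename (ρ : ℕ → ℕ) (σ : ℕ → TySeq B) :
    ∀ S : TySeq B, (S.rename ρ).subst σ = S.subst (fun k => σ (ρ k))
  | .nil => by simp [TySeq.rename, TySeq.subst]
  | .snoc U T => by
      simp only [TySeq.rename, TySeq.subst, TySeq.subst_rename ρ σ U, Ty.subst_rename ρ σ T]
  | .snocC U γ => by simp only [TySeq.rename, TySeq.subst, TySeq.subst_rename ρ σ U]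
end

theorem rename_liftSub (ρ : ℕ → ℕ) (σ : ℕ → TySeq B) :
    (fun k => (liftSub σ k).rename (liftRen ρ)) = liftSub (fun k => (σ k).rename ρ) := by
  funext k
  cases k with
  | zero => simp [liftSub, TySeq.rename, liftRen]
  | succ k => simp only [liftSub, TySeq.rename_rename, liftRen, Nat.succ_eq_add_one]

mutual
theorem Ty.rename_subst (ρ : ℕ → ℕ) (σ : ℕ → TySeq B) :
    ∀ T : Ty B, (T.subst σ).rename ρ = T.subst (fun k => (σ k).rename ρ)
  | .base _ => by simp [Ty.rename, Ty.subst]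
  | .arr S T => by
      simp only [Ty.rename, Ty.subst, Ty.rename_subst ρ σ S, Ty.rename_subst ρ σ T]
  | .box S T => by
      simp only [Ty.rename, Ty.subst, TySeq.rename_subst ρ σ S, Ty.rename_subst ρ σ T]
  | .all T => by
      simp only [Ty.rename, Ty.subst, Ty.rename_subst (liftRen ρ) (liftSub σ) T, rename_liftSub]
theorem TySeq.rename_subst (ρ : ℕ → ℕ) (σ : ℕ → TySeq B) :
    ∀ S : TySeq B, (S.subst σ).rename ρ = S.subst (fun k => (σ k).rename ρ)
  | .nil => by simp [TySeq.rename, TySeq.subst]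
  | .snoc U T => by
      simp only [TySeq.rename, TySeq.subst, TySeq.rename_subst ρ σ U, Ty.rename_subst ρ σ T]
  | .snocC U γ => by
      simp only [TySeq.subst, TySeq.append_eq, TySeq.rename_append, TySeq.rename_subst ρ σ U]
end

theorem subst_liftSub (σ τ : ℕ → TySeq B) :
    (fun k => (liftSub σ k).subst (liftSub τ)) = liftSub (fun k => (σ k).subst τ) := by
  funext k
  cases k with
  | zero => simp [liftSub, TySeq.subst]
  | succ k => simp only [liftSub, TySeq.subst_rename, TySeq.rename_subst]

mutual
theorem Ty.subst_subst (σ τ : ℕ → TySeq B) :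
    ∀ T : Ty B, (T.subst σ).subst τ = T.subst (fun k => (σ k).subst τ)
  | .base _ => by simp [Ty.subst]
  | .arr S T => by simp only [Ty.subst, Ty.subst_subst σ τ S, Ty.subst_subst σ τ T]
  | .box S T => by simp only [Ty.subst, TySeq.subst_subst σ τ S, Ty.subst_subst σ τ T]
  | .all T => by
      simp only [Ty.subst, Ty.subst_subst (liftSub σ) (liftSub τ) T, subst_liftSub]
theorem TySeq.subst_subst (σ τ : ℕ → TySeq B) :
    ∀ S : TySeq B, (S.subst σ).subst τ = S.subst (fun k => (σ k).subst τ)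
  | .nil => by simp [TySeq.subst]
  | .snoc U T => by
      simp only [TySeq.subst, TySeq.subst_subst σ τ U, Ty.subst_subst σ τ T]
  | .snocC U γ => by
      simp only [TySeq.subst, TySeq.append_eq, TySeq.subst_append, TySeq.subst_subst σ τ U]
end

/-- Passing below `n` binders of context variables. -/
def liftSubN : ℕ → (ℕ → TySeq B) → ℕ → TySeq B
  | 0, σ => σ
  | n + 1, σ => liftSubN n (liftSub σ)

theorem liftSubN_add (n : ℕ) (σ : ℕ → TySeq B) (k : ℕ) :
    liftSubN n σ (k + n) = (σ k).rename (· + n) := by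
  induction n generalizing σ k with
  | zero => simp [liftSubN, TySeq.rename_eq_subst, TySeq.subst_idSub]
  | succ n ih =>
    rw [show k + (n + 1) = (k + 1) + n by omega, liftSubN, ih, liftSub, TySeq.rename_rename]
    congr 1
    funext j
    simp only [Nat.succ_eq_add_one]
    omega

/-- The indices below `n` are bound by the block itself, so a substitution coming from outside
cannot touch them. -/
theorem liftSubN_of_lt {n k : ℕ} (σ : ℕ → TySeq B) (h : k < n) :
    liftSubN n σ k = idSub k := by
  induction n generalizing σ k with
  | zero => omega
  | succ n ih =>
    rcases Nat.lt_succ_iff_lt_or_eq.mp h with h | rfl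
    · exact ih _ h
    · have := liftSubN_add k (liftSub σ) 0
      simpa [liftSub, TySeq.rename, idSub, liftSubN] using this

theorem subst_liftSubN (n : ℕ) (σ τ : ℕ → TySeq B) :
    (fun k => (liftSubN n σ k).subst (liftSubN n τ)) =
      liftSubN n (fun k => (σ k).subst τ) := by
  induction n generalizing σ τ with
  | zero => rfl
  | succ n ih => simp only [liftSubN, ih, subst_liftSub]

theorem subst_allN (n : ℕ) (σ : ℕ → TySeq B) (T : Ty B) :
    (allN n T).subst σ = allN n (T.subst (liftSubN n σ)) := by
  induction n generalizing σ with
  | zero => rfl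
  | succ n ih => simp only [allN, Ty.subst, ih, liftSubN]

/-! ### Allocators -/

namespace Alloc

theorem append_apply (P Q : Alloc B) (x : ℕ) : (P ++ Q) x = P x ++ Q x := rfl

theorem append_assoc (P Q R : Alloc B) : P ++ Q ++ R = P ++ (Q ++ R) := by
  funext x
  simp only [append_apply, TySeq.append_assoc]

theorem append_empty (P : Alloc B) : P ++ empty = P := rfl

theorem shift_append (P Q : Alloc B) (n : ℕ) : (P ++ Q).shift n = P.shift n ++ Q.shift n := by
  funext x
  simp only [shift, append_apply, TySeq.rename_append]

theorem shift_empty (n : ℕ) : (empty : Alloc B).shift n = empty := by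
  funext x
  simp [shift, empty, TySeq.rename]

theorem shift_up (P : Alloc B) (n : ℕ) : P.up.shift n = (P.shift n).up := rfl

theorem shift_gen {m : ℕ} (γ : Fin m → ℕ) (n : ℕ) :
    (gen γ : Alloc B).shift n = gen (fun x => γ x + n) := by
  funext x
  by_cases h : x < m <;> simp [shift, gen, h, TySeq.rename]

theorem below_gen {n : ℕ} (γ : Fin n → ℕ) : (gen γ : Alloc B).below n = gen γ := by
  funext x
  by_cases h : x < n <;> simp [below, gen, h]

/-- At each level one side of the cut is empty, so the blocks can be regrouped. This puts the result
of an instantiation into the form that `contr` accepts. -/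
theorem append_below (P : Alloc B) (n : ℕ) :
    P ++ P.below n = P.below n ++ P.below n ++ P.above n := by
  funext x
  by_cases h : x < n <;> simp [append_apply, below, above, h]

theorem below_append_above (P : Alloc B) (n : ℕ) : P.below n ++ P.above n = P := by
  funext x
  by_cases h : x < n <;> simp [append_apply, below, above, h]

end Alloc

-- Translation of types: locality and substitution

/-- The translation of `T` depends on the levels below the depth of `T` only. -/
theorem trTy_congr {P Q : Alloc B} {T : LTy B} (h : ∀ x < T.depth, P x = Q x) :
    trTy P T = trTy Q T := by
  induction T generalizing P Q with
  | base b => rfl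
  | arr S T _ ih =>
    simp only [trTy]
    rw [ih]
    intro x hx
    simp only [Alloc.append_apply, Alloc.shift, h x hx]
  | circ T ih =>
    simp only [trTy]
    rw [ih (P := P.up) (Q := Q.up) fun x hx => h (x + 1) (by simp only [LTy.depth]; omega),
      h 0 (by simp only [LTy.depth]; omega)]

/-- The translation uses the entries of its allocator only by placing them in boxes, and shifts them
below each block of quantifiers. The lifted substitution respects this shift and fixes the variables
of the block. -/
theorem subst_trTy (σ : ℕ → TySeq B) (P : Alloc B) (T : LTy B) :
    (trTy P T).subst σ = trTy (fun x => (P x).subst σ) T := by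
  induction T generalizing P σ with
  | base b => simp [trTy, Ty.subst]
  | arr S T ihS ihT =>
    have hR : (fun x => ((Alloc.gen (boundVars S.depth) : Alloc B) x).subst
        (liftSubN S.depth σ)) = Alloc.gen (boundVars S.depth) := by
      funext x
      by_cases h : x < S.depth
      -- The variable of level `x` has index `n - (x + 1)`, since the last binder of the block is
      -- the innermost.
      · have h' : S.depth - (x + 1) < S.depth := by omega
        simp [Alloc.gen, h, TySeq.subst, boundVars, liftSubN_of_lt σ h', idSub]
      · simp [Alloc.gen, h, TySeq.subst]
    simp only [trTy, subst_allN, Ty.subst, ihS, ihT, hR]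
    congr 3
    funext x
    simp only [Alloc.append_apply, TySeq.subst_append, Alloc.shift, TySeq.subst_rename,
      liftSubN_add, TySeq.rename_subst]
    rw [congrFun hR x]
  | circ T ih =>
    simp only [trTy, Ty.subst, ih]
    rfl

theorem rename_trTy (n : ℕ) (P : Alloc B) (T : LTy B) :
    (trTy P T).rename (· + n) = trTy (P.shift n) T := by
  rw [Ty.rename_eq_subst, subst_trTy]
  congr 1
  funext x
  rw [Alloc.shift, TySeq.rename_eq_subst]

/-! ### Blocks of context variables -/

/-- The substitution of `P(0), …, P(n - 1)` for the context variables of a block of length `n`. -/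
def instN (P : Alloc B) : ℕ → ℕ → TySeq B
  | 0, k => idSub k
  | n + 1, 0 => P n
  | n + 1, k + 1 => instN P n k

theorem instN_add (P : Alloc B) (n k : ℕ) : instN P n (k + n) = idSub k := by
  induction n with
  | zero => rfl
  | succ n ih => exact ih

/-- Matches the reversed numbering of `boundVars`: index `0` is the last variable of the block. -/
theorem instN_sub (P : Alloc B) {n x : ℕ} (h : x < n) : instN P n (n - (x + 1)) = P x := by
  induction n with
  | zero => omega
  | succ n ih =>
    rcases Nat.lt_succ_iff_lt_or_eq.mp h with h | rfl
    · rw [show n + 1 - (x + 1) = n - (x + 1) + 1 by omega]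
      exact ih h
    · rw [Nat.sub_self]
      rfl

theorem subst_instN_shift (P Q : Alloc B) (n x : ℕ) :
    (P.shift n x).subst (instN Q n) = P x := by
  simp only [Alloc.shift, TySeq.subst_rename, instN_add]
  exact TySeq.subst_idSub _

theorem subst_instN_gen (P : Alloc B) (n x : ℕ) :
    ((Alloc.gen (boundVars n) : Alloc B) x).subst (instN P n) = P.below n x := by
  by_cases h : x < n
  · simp [Alloc.gen, Alloc.below, h, boundVars, TySeq.subst, instN_sub P h]
  · simp [Alloc.gen, Alloc.below, h, TySeq.subst]

theorem inst_liftSub_instN (P : Alloc B) (n : ℕ) :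
    (fun k => (liftSub (instN P n) k).subst (inst (P n))) = instN P (n + 1) := by
  funext k
  cases k with
  | zero => simp [liftSub, TySeq.subst, inst, instN]
  | succ k =>
    simp only [liftSub, TySeq.subst_rename, instN]
    exact TySeq.subst_idSub _

-- Typing of blocks of instantiations and abstractions

variable {v : Variant}

/-- The extra `m` quantifiers make the induction work: after some of the arguments have been
supplied, the rest of the block is still in place and the substitution acts below it. -/
theorem typed_cappN_allN {Ψ : Stack B} {M : Tm B} (P : Alloc B) {n m : ℕ} {T : Ty B}
    (h : Typed v Ψ M (allN (n + m) T)) :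
    Typed v Ψ (cappN M P n) (allN m (T.subst (liftSubN m (instN P n)))) := by
  induction n generalizing m with
  | zero =>
    have hid : liftSubN m (instN P 0) = (idSub : ℕ → TySeq B) := by
      funext k
      by_cases hk : k < m
      · exact liftSubN_of_lt _ hk
      · obtain ⟨j, rfl⟩ : ∃ j, k = j + m := ⟨k - m, by omega⟩
        simp [liftSubN_add, instN, idSub, TySeq.rename]
    rw [hid, Ty.subst_idSub]
    simpa [cappN] using h
  | succ n ih =>
    -- After the first `n` arguments, the outermost of the `m + 1` remaining quantifiers is the one
    -- that receives `P n`.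
    have h' := ih (m := m + 1) (by rwa [show n + (m + 1) = n + 1 + m by omega])
    have h2 := Typed.inst (P n) h'
    rw [subst_allN, Ty.subst_subst, liftSubN, subst_liftSubN, inst_liftSub_instN] at h2
    exact h2

theorem typed_cappN {Ψ : Stack B} {M : Tm B} {A : Alloc B} (P : Alloc B) {S T : LTy B}
    (h : Typed v Ψ M (trTy A (.arr S T))) :
    Typed v Ψ (cappN M P S.depth) (.arr (trTy P S) (trTy (A ++ P.below S.depth) T)) := by
  have h2 := typed_cappN_allN (v := v) P (n := S.depth) (m := 0) h
  simp only [liftSubN, allN, Ty.subst, subst_trTy, subst_instN_gen] at h2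
  convert h2 using 2
  -- Substitution yields `P.below S.depth` in the domain; by locality this is as good as `P`.
  · refine trTy_congr fun x hx => ?_
    simp [Alloc.below, hx]
  · congr 1
    funext x
    simp only [Alloc.append_apply, TySeq.subst_append, subst_instN_shift, subst_instN_gen]

theorem typed_clamN {Ψ : Stack B} {M : Tm B} {n : ℕ} {T : Ty B}
    (h : Typed v (Ψ.map (TySeq.rename (· + n))) M T) : Typed v Ψ (clamN n M) (allN n T) := by
  induction n generalizing Ψ with
  | zero =>
    have hid : (TySeq.rename (· + 0) : TySeq B → TySeq B) = id := by
      funext S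
      simpa [TySeq.rename_eq_subst] using TySeq.subst_idSub S
    rw [hid, List.map_id] at h
    exact h
  | succ n ih =>
    refine .poly (ih ?_)
    rw [List.map_map]
    convert h using 2
    funext S
    simp only [Function.comp, TySeq.rename_rename, Nat.succ_eq_add_one]
    congr 1
    funext k
    omega

/-! ### Inclusion of contexts -/

/-- Every entry `k` of `Γ` is the entry `ι k` of `Δ`. -/
structure Incl (Γ Δ : Ctx B) (ι : ℕ → ℕ) : Prop where
  var {k : ℕ} {T : Ty B} : HasVar Γ k T → HasVar Δ (ι k) T
  wvar {k γ : ℕ} : HasWVar Γ k γ → HasWVar Δ (ι k) γ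

theorem HasVar.lt {Γ : Ctx B} {k : ℕ} {T : Ty B} (h : HasVar Γ k T) : k < Γ.length := by
  induction h <;> simp only [TySeq.length] <;> omega

theorem HasWVar.lt {Γ : Ctx B} {k γ : ℕ} (h : HasWVar Γ k γ) : k < Γ.length := by
  induction h <;> simp only [TySeq.length] <;> omega

theorem incl_append_right (Γ Δ : Ctx B) : Incl Δ (Γ ++ Δ) id := by
  constructor
  · intro k T h
    induction h with
    | here => exact .here
    | thereV _ ih => exact .thereV ih
    | thereC _ ih => exact .thereC ih
  · intro k γ h
    induction h with
    | here => exact .here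
    | thereV _ ih => exact .thereV ih
    | thereC _ ih => exact .thereC ih

theorem incl_append_left (Γ : Ctx B) : ∀ Δ : Ctx B, Incl Γ (Γ ++ Δ) (· + Δ.length)
  | .nil => ⟨fun h => h, fun h => h⟩
  | .snoc Δ _ => ⟨fun h => .thereV ((incl_append_left Γ Δ).var h),
      fun h => .thereV ((incl_append_left Γ Δ).wvar h)⟩
  | .snocC Δ _ => ⟨fun h => .thereC ((incl_append_left Γ Δ).var h),
      fun h => .thereC ((incl_append_left Γ Δ).wvar h)⟩

theorem Incl.trans {Γ Δ Ξ : Ctx B} {ι κ : ℕ → ℕ} (h : Incl Γ Δ ι) (h' : Incl Δ Ξ κ) :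
    Incl Γ Ξ (fun k => κ (ι k)) :=
  ⟨fun hk => h'.var (h.var hk), fun hk => h'.wvar (h.wvar hk)⟩

theorem hasVar_append {Γ Δ : Ctx B} {k : ℕ} {T : Ty B} (h : HasVar (Γ ++ Δ) k T) :
    HasVar Δ k T ∨ ∃ j, k = j + Δ.length ∧ HasVar Γ j T := by
  -- Types and type sequences are mutually inductive; the motive on types is trivial because only
  -- the spine of the sequence matters.
  induction Δ using TySeq.rec (motive_1 := fun _ => True) generalizing k with
  | nil => exact .inr ⟨k, rfl, h⟩
  | snoc Δ S ih _ =>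
    cases h with
    | here => exact .inl .here
    | thereV h =>
      rcases ih h with h | ⟨j, rfl, hj⟩
      · exact .inl (.thereV h)
      · exact .inr ⟨j, rfl, hj⟩
  | snocC Δ γ ih =>
    cases h with
    | thereC h =>
      rcases ih h with h | ⟨j, rfl, hj⟩
      · exact .inl (.thereC h)
      · exact .inr ⟨j, rfl, hj⟩
  | _ => trivial

theorem hasWVar_append {Γ Δ : Ctx B} {k γ : ℕ} (h : HasWVar (Γ ++ Δ) k γ) :
    HasWVar Δ k γ ∨ ∃ j, k = j + Δ.length ∧ HasWVar Γ j γ := by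
  induction Δ using TySeq.rec (motive_1 := fun _ => True) generalizing k with
  | nil => exact .inr ⟨k, rfl, h⟩
  | snoc Δ S ih _ =>
    cases h with
    | thereV h =>
      rcases ih h with h | ⟨j, rfl, hj⟩
      · exact .inl (.thereV h)
      · exact .inr ⟨j, rfl, hj⟩
  | snocC Δ γ ih =>
    cases h with
    | here => exact .inl .here
    | thereC h =>
      rcases ih h with h | ⟨j, rfl, hj⟩
      · exact .inl (.thereC h)
      · exact .inr ⟨j, rfl, hj⟩
  | _ => trivial

theorem Incl.append {Γ Δ : Ctx B} {ι : ℕ → ℕ} (h : Incl Γ Δ ι) (Ξ : Ctx B) :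
    Incl (Γ ++ Ξ) (Δ ++ Ξ) (liftPos Ξ.length ι) := by
  constructor
  · intro k T hk
    rcases hasVar_append hk with hk | ⟨j, rfl, hj⟩
    · simpa [liftPos, hk.lt] using (incl_append_right Δ Ξ).var hk
    · simpa [liftPos] using (incl_append_left Δ Ξ).var (h.var hj)
  · intro k T hk
    rcases hasWVar_append hk with hk | ⟨j, rfl, hj⟩
    · simpa [liftPos, hk.lt] using (incl_append_right Δ Ξ).wvar hk
    · simpa [liftPos] using (incl_append_left Δ Ξ).wvar (h.wvar hj)

theorem HasVar.rename (ρ : ℕ → ℕ) {Γ : Ctx B} {k : ℕ} {T : Ty B} (h : HasVar Γ k T) :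
    HasVar (Γ.rename ρ) k (T.rename ρ) := by
  induction h with
  | here => simpa only [TySeq.rename] using .here
  | thereV _ ih => simpa only [TySeq.rename] using .thereV ih
  | thereC _ ih => simpa only [TySeq.rename] using .thereC ih

theorem HasWVar.rename (ρ : ℕ → ℕ) {Γ : Ctx B} {k γ : ℕ} (h : HasWVar Γ k γ) :
    HasWVar (Γ.rename ρ) k (ρ γ) := by
  induction h with
  | here => simpa only [TySeq.rename] using .here
  | thereV _ ih => simpa only [TySeq.rename] using .thereV ih
  | thereC _ ih => simpa only [TySeq.rename] using .thereC ih

theorem hasVar_rename {ρ : ℕ → ℕ} {Γ : Ctx B} {k : ℕ} {T : Ty B}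
    (h : HasVar (Γ.rename ρ) k T) : ∃ S, T = S.rename ρ ∧ HasVar Γ k S := by
  induction Γ using TySeq.rec (motive_1 := fun _ => True) generalizing k with
  | nil => simp only [TySeq.rename] at h; cases h
  | snoc Δ S ih _ =>
    simp only [TySeq.rename] at h
    cases h with
    | here => exact ⟨S, rfl, .here⟩
    | thereV h =>
      obtain ⟨S', e, h'⟩ := ih h
      exact ⟨S', e, .thereV h'⟩
  | snocC Δ γ ih =>
    simp only [TySeq.rename] at h
    cases h with
    | thereC h =>
      obtain ⟨S', e, h'⟩ := ih h
      exact ⟨S', e, .thereC h'⟩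
  | _ => trivial

theorem hasWVar_rename {ρ : ℕ → ℕ} {Γ : Ctx B} {k γ : ℕ}
    (h : HasWVar (Γ.rename ρ) k γ) : ∃ δ, γ = ρ δ ∧ HasWVar Γ k δ := by
  induction Γ using TySeq.rec (motive_1 := fun _ => True) generalizing k with
  | nil => simp only [TySeq.rename] at h; cases h
  | snoc Δ S ih _ =>
    simp only [TySeq.rename] at h
    cases h with
    | thereV h =>
      obtain ⟨S', e, h'⟩ := ih h
      exact ⟨S', e, .thereV h'⟩
  | snocC Δ δ ih =>
    simp only [TySeq.rename] at h
    cases h with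
    | here => exact ⟨δ, rfl, .here⟩
    | thereC h =>
      obtain ⟨S', e, h'⟩ := ih h
      exact ⟨S', e, .thereC h'⟩
  | _ => trivial

theorem Incl.rename {Γ Δ : Ctx B} {ι : ℕ → ℕ} (h : Incl Γ Δ ι) (ρ : ℕ → ℕ) :
    Incl (Γ.rename ρ) (Δ.rename ρ) ι := by
  constructor
  · intro k T hk
    obtain ⟨S, rfl, hS⟩ := hasVar_rename hk
    exact (h.var hS).rename ρ
  · intro k γ hk
    obtain ⟨δ, rfl, hδ⟩ := hasWVar_rename hk
    exact (h.wvar hδ).rename ρ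

theorem typedSeq_domVia {Ψ : Stack B} {Δ : Ctx B} :
    ∀ {Γ : Ctx B} {ι : ℕ → ℕ}, Incl Γ Δ ι → TypedSeq v (Δ :: Ψ) (domVia Γ ι) Γ
  | .nil, _, _ => by simpa only [domVia] using .unit
  | .snoc Γ T, ι, h => by
      simpa only [domVia] using .seq
        (typedSeq_domVia ⟨fun hk => h.var (.thereV hk), fun hk => h.wvar (.thereV hk)⟩)
        (.var (h.var .here))
  | .snocC Γ γ, ι, h => by
      simpa only [domVia] using .seqC
        (typedSeq_domVia ⟨fun hk => h.var (.thereC hk), fun hk => h.wvar (.thereC hk)⟩)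
        (h.wvar .here)

theorem typedSeq_append {Ψ : Stack B} {M : TmSeq B} {S : TySeq B} (hM : TypedSeq v Ψ M S) :
    ∀ {N : TmSeq B} {T : TySeq B}, TypedSeq v Ψ N T → TypedSeq v Ψ (M ++ N) (S ++ T)
  | _, _, .unit => hM
  | _, _, .seq hN h => .seq (typedSeq_append hM hN) h
  | _, _, .seqC hN h => .seqC (typedSeq_append hM hN) h

/-! ### Conversions between translations of types -/

/-- The domain of a translated arrow does not involve the allocator, so the argument is passed on
unchanged and only the result is converted. The conversion `c` is required in every nonempty stack,
as it is used below new binders. -/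
theorem typed_conv_arr {Ψ : Stack B} {Γ : Ctx B} {A C : Alloc B} {S T : LTy B} {c : Tm B}
    (hc : ∀ (Ψ : Stack B) (Γ : Ctx B), Typed v (Γ :: Ψ) c
      (.arr (trTy (A.shift S.depth ++ .gen (boundVars S.depth)) T)
        (trTy (C.shift S.depth ++ .gen (boundVars S.depth)) T))) :
    Typed v (Γ :: Ψ) (.lam (trTy A (.arr S T)) (clamN S.depth
      (.lam (trTy (.gen (boundVars S.depth)) S)
        (.app c (.app (cappN (.var 1) (.gen (boundVars S.depth)) S.depth) (.var 0))))))
      (.arr (trTy A (.arr S T)) (trTy C (.arr S T))) := by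
  refine .abs (typed_clamN (.abs (.app (hc _ _) (.app ?_ (.var .here)))))
  have h := typed_cappN (v := v) (A := A.shift S.depth) (.gen (boundVars S.depth)) (S := S)
    (T := T) (M := .var 1) (.var (Ψ := Ψ.map (TySeq.rename (· + S.depth)))
      (Γ := ((Γ.snoc (trTy A (.arr S T))).rename (· + S.depth)).snoc
        (trTy (.gen (boundVars S.depth)) S)) (by
        -- The function was bound outside the `Λ`-block; inside it, its type is the translation at
        -- the shifted allocator.
        simp only [TySeq.rename, rename_trTy]
        exact .thereV .here))
  -- Instantiating with the block itself adds exactly `R`, which is empty from level `n` on.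
  rwa [Alloc.below_gen] at h

theorem typed_conv_circ {Ψ : Stack B} {Γ : Ctx B} {A C : Alloc B} {T : LTy B} {c : Tm B}
    {N : TmSeq B}
    (hc : ∀ (Ψ : Stack B) (Γ : Ctx B), Typed .K (Γ :: Ψ) c (.arr (trTy A.up T) (trTy C.up T)))
    (hN : ∀ Ψ : Stack B, TypedSeq .K (C 0 :: Ψ) N (A 0)) :
    Typed .K (Γ :: Ψ) (.lam (trTy A (.circ T)) (.quo (C 0) (.app c (.unq 1 (.var 0) N))))
      (.arr (trTy A (.circ T)) (trTy C (.circ T))) :=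
  .abs (.quo (.app (hc _ _) (.unq (Δ := [C 0]) rfl rfl (.var .here) (hN _))))

theorem typed_weak {P Q : Alloc B} {ι : ℕ → ℕ → ℕ} {T : LTy B}
    (h : ∀ x, Incl (P x) (Q x) (ι x)) (Ψ : Stack B) (Γ : Ctx B) :
    Typed .K (Γ :: Ψ) (weak P Q ι T) (.arr (trTy P T) (trTy Q T)) := by
  induction T generalizing P Q ι Ψ Γ with
  | base b => exact .abs (.var .here)
  | arr S T _ ih => exact typed_conv_arr (ih fun x => ((h x).rename _).append _)
  | circ T ih => exact typed_conv_circ (ih fun x => h (x + 1)) fun _ => typedSeq_domVia (h 0)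

theorem typed_contr {P Q : Alloc B} {T : LTy B} (Ψ : Stack B) (Γ : Ctx B) :
    Typed .K (Γ :: Ψ) (contr P Q T) (.arr (trTy (P ++ P ++ Q) T) (trTy (P ++ Q) T)) := by
  induction T generalizing P Q Ψ Γ with
  | base b => exact .abs (.var .here)
  | arr S T _ ih =>
    refine typed_conv_arr fun Ψ Γ => ?_
    simpa only [Alloc.shift_append, Alloc.append_assoc] using
      ih (P := P.shift S.depth) (Q := Q.shift S.depth ++ .gen (boundVars S.depth)) Ψ Γ
  | circ T ih =>
    refine typed_conv_circ (C := P ++ Q) ih fun _ => ?_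
    have hP := incl_append_left (P 0) (Q 0)
    exact typedSeq_append (typedSeq_append (typedSeq_domVia hP) (typedSeq_domVia hP))
      (typedSeq_domVia (incl_append_right (P 0) (Q 0)))

theorem typed_exchg {P Q P' Q' : Alloc B} {T : LTy B} (Ψ : Stack B) (Γ : Ctx B) :
    Typed .K (Γ :: Ψ) (exchg P Q P' Q' T)
      (.arr (trTy (P ++ Q ++ P' ++ Q') T) (trTy (P ++ P' ++ Q ++ Q') T)) := by
  induction T generalizing P Q P' Q' Ψ Γ with
  | base b => exact .abs (.var .here)
  | arr S T _ ih =>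
    refine typed_conv_arr fun Ψ Γ => ?_
    simpa only [Alloc.shift_append, Alloc.append_assoc] using
      ih (P := P.shift S.depth) (Q := Q.shift S.depth) (P' := P'.shift S.depth)
        (Q' := Q'.shift S.depth ++ .gen (boundVars S.depth)) Ψ Γ
  | circ T ih =>
    refine typed_conv_circ (C := P ++ P' ++ Q ++ Q') ih fun _ => ?_
    -- Each block is located in the target order `P, P', Q, Q'`: its offset is the total length of
    -- the blocks to its right there.
    have hQ' := incl_append_right (P 0 ++ P' 0 ++ Q 0) (Q' 0)
    have hQ := (incl_append_right (P 0 ++ P' 0) (Q 0)).trans (incl_append_left _ (Q' 0))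
    have hP' := (incl_append_right (P 0) (P' 0)).trans (incl_append_left _ (Q 0 ++ Q' 0))
    have hP := incl_append_left (P 0) (P' 0 ++ (Q 0 ++ Q' 0))
    simp only [TySeq.length_append, ← TySeq.append_assoc, ← Nat.add_assoc, id] at hP hP' hQ
    simp only [← Nat.add_assoc]
    exact typedSeq_append (typedSeq_append (typedSeq_append (typedSeq_domVia hP)
      (typedSeq_domVia hQ)) (typedSeq_domVia (by simpa only [Nat.add_assoc] using hP')))
      (typedSeq_domVia hQ')

/-! ### Generative translations -/

namespace GenCtx

theorem alloc_shift (n : ℕ) {Γ : LCtx B} : ∀ g : GenCtx Γ, (g.shift n).alloc = g.alloc.shift n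
  | .nil => (Alloc.shift_empty n).symm
  | .snoc g _ _ => by simp only [shift, alloc, Alloc.shift_append, Alloc.shift_gen, alloc_shift n g]

theorem ctx_shift (n : ℕ) {Γ : LCtx B} : ∀ g : GenCtx Γ, (g.shift n).ctx = g.ctx.rename (· + n)
  | .nil => by simp only [shift, ctx, TySeq.rename]
  | .snoc g _ _ => by
      simp only [shift, ctx, TySeq.rename, rename_trTy, Alloc.shift_gen, ctx_shift n g]

theorem hasVar_ctx {Γ : LCtx B} {T : LTy B} :
    ∀ (g : GenCtx Γ) {x : ℕ}, Γ[x]? = some T → HasVar g.ctx x (trTy (g.varAlloc x) T)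
  | .snoc _ _ _, 0, h => by
      obtain rfl : _ = T := by simpa using h
      exact .here
  | .snoc g _ _, x + 1, h => .thereV (g.hasVar_ctx (by simpa using h))

theorem incl_varAlloc (l : ℕ) {Γ : LCtx B} : ∀ (g : GenCtx Γ) (x : ℕ),
    Incl (g.varAlloc x l) (g.alloc l) (· + (g.allocAfter x l).length)
  | .nil, _ => ⟨fun h => (nomatch h), fun h => (nomatch h)⟩
  | .snoc g _ γ, 0 => incl_append_right (g.alloc l) (Alloc.gen γ l)
  | .snoc g _ γ, x + 1 => by
      have h := (g.incl_varAlloc l x).trans (incl_append_left _ (Alloc.gen γ l))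
      simp only [Nat.add_assoc] at h
      simp only [allocAfter, Alloc.append_apply, TySeq.length_append]
      exact h

end GenCtx

namespace GenPast

theorem alloc_shift (n : ℕ) {Ψ : List (LCtx B)} :
    ∀ p : GenPast Ψ, (p.shift n).alloc = p.alloc.shift n
  | .nil => (Alloc.shift_empty n).symm
  | .snoc p g => by
      simp only [shift, alloc, Alloc.shift_append, Alloc.shift_up, alloc_shift n p,
        GenCtx.alloc_shift]

theorem stack_shift (n : ℕ) {Ψ : List (LCtx B)} :
    ∀ p : GenPast Ψ, (p.shift n).stack = p.stack.map (TySeq.rename (· + n))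
  | .nil => rfl
  | .snoc p g => by
      simp only [shift, stack, List.map_cons, TySeq.rename_append, alloc_shift n p,
        GenCtx.ctx_shift, stack_shift n p, Alloc.shift]

end GenPast

theorem GenFuture.alloc_shift (n : ℕ) {Θ : List (LCtx B)} :
    ∀ f : GenFuture Θ, (f.shift n).alloc = f.alloc.shift n
  | .nil => (Alloc.shift_empty n).symm
  | .cons g f => by
      funext x
      cases x <;> simp only [shift, alloc, Alloc.down, GenCtx.alloc_shift, GenCtx.ctx_shift,
        alloc_shift n f, Alloc.shift, Alloc.append_apply, TySeq.rename_append]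

-- Existence of fresh choices

theorem exists_genCtx_cvars (k : ℕ) : ∀ Γ : LCtx B,
    ∃ (g : GenCtx Γ) (n : ℕ), g.cvars = List.range' k n
  | [] => ⟨.nil, 0, rfl⟩
  | T :: Γ => by
      obtain ⟨g, n, h⟩ := exists_genCtx_cvars k Γ
      refine ⟨.snoc g T (fun x => k + n + x), n + T.depth, ?_⟩
      rw [GenCtx.cvars, h, ← List.range'_append_1]
      congr 1
      apply List.ext_getElem <;> simp

theorem exists_genPast_cvars (k : ℕ) : ∀ Ψ : List (LCtx B),
    ∃ (p : GenPast Ψ) (n : ℕ), p.cvars = List.range' k n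
  | [] => ⟨.nil, 0, rfl⟩
  | Γ :: Ψ => by
      obtain ⟨p, n, h⟩ := exists_genPast_cvars k Ψ
      obtain ⟨g, m, h'⟩ := exists_genCtx_cvars (k + n) Γ
      exact ⟨.snoc p g, n + m, by rw [GenPast.cvars, h, h', ← List.range'_append_1]⟩

theorem exists_genFuture_cvars (k : ℕ) : ∀ Θ : List (LCtx B),
    ∃ (f : GenFuture Θ) (n : ℕ), f.cvars = List.range' k n
  | [] => ⟨.nil, 0, rfl⟩
  | Γ :: Θ => by
      obtain ⟨g, n, h⟩ := exists_genCtx_cvars k Γ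
      obtain ⟨f, m, h'⟩ := exists_genFuture_cvars (k + n) Θ
      exact ⟨.cons g f, n + m, by rw [GenFuture.cvars, h, h', ← List.range'_append_1]⟩

theorem exists_fresh (Ψ Θ : List (LCtx B)) : ∃ (p : GenPast Ψ) (f : GenFuture Θ), Fresh p f := by
  obtain ⟨p, n, h⟩ := exists_genPast_cvars 0 Ψ
  obtain ⟨f, m, h'⟩ := exists_genFuture_cvars (0 + n) Θ
  refine ⟨p, f, ?_⟩
  rw [Fresh, h, h', List.range'_append_1]
  exact List.nodup_range'

/-! ### Soundness -/

/-- Without a current context no term has a function type. -/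
theorem LDer.ne_arr_of_nil {Ψ Θ : List (LCtx B)} {M : LTm B} {T : LTy B} (d : LDer Ψ Θ M T)
    (h : Ψ = []) (S U : LTy B) : T ≠ .arr S U := by
  induction d generalizing S U with
  | app _ _ ih _ => exact absurd rfl (ih h _ _)
  | quo => nofun
  | _ => cases h

theorem typed_trTm {Ψ Θ : List (LCtx B)} {M : LTm B} {T : LTy B} (d : LDer Ψ Θ M T)
    (p : GenPast Ψ) (f : GenFuture Θ) :
    Typed .K p.stack (trTm d p f) (trTy (p.alloc ++ f.alloc) T) := by
  induction d with
  | var x h =>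
    cases p with | snoc p g =>
    refine .app (typed_weak (fun l => ?_) _ _)
      (.var ((incl_append_right _ _).var (g.hasVar_ctx h)))
    have hg := (g.incl_varAlloc l x).trans (incl_append_right (p.alloc.up l) _)
    exact hg.trans (incl_append_left _ (f.alloc l))
  | @abs Ψ Θ Γ M S T d ih =>
    cases p with | snoc p g =>
    -- Below the `Λ`-block the old choices are shifted, and the new variable gets the bound context
    -- variables as its own choice.
    have hd := ih ((p.shift S.depth).snoc ((g.shift S.depth).snoc S (boundVars S.depth)))
      (f.shift S.depth)
    refine typed_clamN ?_
    rw [← GenPast.stack_shift]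
    refine .abs (.app (T := trTy ((((p.shift S.depth).snoc (g.shift S.depth)).alloc ++
      .gen (boundVars S.depth)) ++ (f.shift S.depth).alloc ++ .empty) T) ?_ ?_)
    · rw [Alloc.shift_append, ← GenPast.alloc_shift, ← GenFuture.alloc_shift]
      exact typed_exchg _ _
    · rw [Alloc.append_empty]
      simp only [GenPast.alloc, GenCtx.alloc, Alloc.append_assoc] at hd ⊢
      exact hd
  | @app Ψ Θ M N S T d e ihd ihe =>
    cases p with
    | nil => exact absurd rfl (d.ne_arr_of_nil rfl S T)
    | snoc p g =>
      have h := typed_cappN ((p.snoc g).alloc ++ f.alloc) (ihd (p.snoc g) f)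
      -- The instantiated result type is at `A ⊕ A_{<n}`; regrouping makes it the source type of
      -- `contr`.
      rw [Alloc.append_below] at h
      have h' := typed_contr (P := ((p.snoc g).alloc ++ f.alloc).below S.depth)
        (Q := ((p.snoc g).alloc ++ f.alloc).above S.depth) (T := T) p.stack
        (p.alloc 0 ++ g.ctx)
      rw [Alloc.below_append_above] at h'
      exact .app h' (.app h (ihe (p.snoc g) f))
  | quo d ih =>
    cases f with | cons g f =>
    have hd := ih (p.snoc g) f
    simp only [GenPast.alloc, Alloc.append_assoc] at hd
    exact .quo hd
  | unq d ih =>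
    cases p with | snoc p g =>
    have hd := ih p (.cons g f)
    simp only [GenPast.alloc, Alloc.append_assoc]
    -- Level `0` of the allocator in `hd` is the current context itself, so the identity inclusion
    -- types the environment.
    exact .unq (Δ := [p.alloc 0 ++ g.ctx]) rfl rfl hd
      (typedSeq_domVia ⟨fun h => h, fun h => h⟩)

end ContextExtraction

open ContextExtraction
theorem mainTheorem1 {B : Type*} {Ψ Θ : List (LCtx B)} {M : LTm B} {T : LTy B}
    (d : LDer Ψ Θ M T) :
    (∃ (p : GenPast Ψ) (f : GenFuture Θ), Fresh p f) ∧
    ∀ (p : GenPast Ψ) (f : GenFuture Θ),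
      Typed Variant.K p.stack (trTm d p f) (trTy (p.alloc ++ f.alloc) T) :=
  ⟨exists_fresh Ψ Θ, typed_trTm d⟩
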